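/- Let $G$ be a profinite group. A \emph{spectrum} is a Bousfield--Friedlander spectrum of simplicial sets, i.e. a sequence of pointed simplicial sets $X_k$ ($k\ge 0$) with pointed structure maps $S^1\wedge X_k\to X_{k+1}$, where $S^1=\Delta^1/\partial\Delta^1$. A \emph{$G$-spectrum} is a spectrum with an action of $G$ by maps of spectra; it is \emph{discrete} if for all $k,l\ge 0$ the action map $G\times (X_k)_l\to (X_k)_l$ is continuous when $(X_k)_l$ has the discrete topology. For a small category $\mathcal C$ and a functor $Z$ from $\mathcal C$ to spectra, $\mathrm{holim}_{\mathcal C}Z$ is the equalizer of the two canonical maps $$\prod_{c\in\mathcal C} Z(c)^{B(\mathcal C\downarrow c)}\rightrightarrows\prod_{\sigma\colon c\to d} Z(d)^{B(\mathcal C\downarrow c)},$$ where $B$ is the nerve and $Z^K$ is the levelwise simplicial mapping spectrum; if $Z$ is a diagram of $G$-spectra, $G$ acts on $\mathrm{holim}_{\mathcal C}Z$ through its action on the $Z(c)$. The site $G\text{-}\mathbf{Sets}_{df}$ is the category of finite discrete $G$-sets (finite sets with continuous $G$-action) with the topology whose covering families are the jointly surjective ones. For a $G$-spectrum $Y$,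 $\mathrm{Hom}_G(-,Y)$ is the presheaf of spectra on this site with $(\mathrm{Hom}_G(S,Y)_k)_l=\mathrm{Hom}_G(S,(Y_k)_l)$. Let $\mathcal C$ be a small category and let $X$ be a $\mathcal C$-diagram of discrete $G$-spectra and equivariant maps. Let $\mathrm{holim}_{\mathcal C}\mathrm{Hom}_G(-,X)$ be the presheaf of spectra $S\mapsto \mathrm{holim}_{\mathcal C}\mathrm{Hom}_G(S,X)$, and let $$\mathcal F=\mathrm{Hom}_G\bigl(-,\ \mathrm{colim}_{N}(\mathrm{holim}_{\mathcal C}X)^N\bigr),$$ where $N$ runs over the open normal subgroups of $G$ and the homotopy limit of $X$ is formed in spectra. Then $\mathcal F$ is a sheaf of spectra on $G\text{-}\mathbf{Sets}_{df}$, and the presheaves of spectra $\mathrm{holim}_{\mathcal C}\mathrm{Hom}_G(-,X)$ and $\mathcal F$ are isomorphic. In particular, $\mathrm{holim}_{\mathcal C}\mathrm{Hom}_G(-,X)$ is a sheaf of spectra. -/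

import Mathlib

open CategoryTheory Opposite MonoidalCategory CartesianMonoidalCategory
open scoped Simplicial FintypeCatDiscrete

universe u

noncomputable section

lemma types_ext {A B : Type u} {f g : A ⟶ B} (h : ∀ a, f a = g a) : f = g :=
  ConcreteCategory.hom_ext _ _ h

lemma sset_map_id {X : SSet.{u}} {n} (x : X.obj n) : X.map (𝟙 n) x = x := by
  simp

lemma sset_map_comp {X : SSet.{u}} {l m n} (θ : l ⟶ m) (θ' : m ⟶ n) (x : X.obj l) :
    X.map (θ ≫ θ') x = X.map θ' (X.map θ x) := by
  simp

/-! ### Pointed simplicial sets, the circle and the smash product -/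

/-- A pointed simplicial set: a simplicial set with a compatible choice of base points
(that is, a map from the terminal simplicial set). -/
structure PointedSSet : Type (u + 1) where
  sset : SSet.{u}
  pt : ∀ n : SimplexCategoryᵒᵖ, sset.obj n
  map_pt : ∀ {m n : SimplexCategoryᵒᵖ} (θ : m ⟶ n), sset.map θ (pt m) = pt n

namespace PointedSSet

/-- Base point preserving simplicial maps. -/
@[ext]
structure Hom (X Y : PointedSSet.{u}) : Type u where
  hom : X.sset ⟶ Y.sset
  hom_pt : ∀ n, hom.app n (X.pt n) = Y.pt n

instance : Category PointedSSet.{u} where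
  Hom X Y := Hom X Y
  id X := ⟨𝟙 X.sset, fun _ => rfl⟩
  comp f g := ⟨f.hom ≫ g.hom, fun n => by
    rw [NatTrans.comp_app, types_comp_apply, f.hom_pt, g.hom_pt]⟩

@[ext]
lemma hom_ext {X Y : PointedSSet.{u}} {f g : X ⟶ Y}
    (h : ∀ n x, f.hom.app n x = g.hom.app n x) : f = g := by
  apply Hom.ext
  ext n x
  exact h n x

@[simp] lemma id_app {X : PointedSSet.{u}} (n) (x : X.sset.obj n) :
    (Hom.hom (𝟙 X)).app n x = x := rfl

@[simp] lemma comp_app {X Y Z : PointedSSet.{u}} (f : X ⟶ Y) (g : Y ⟶ Z) (n) (x : X.sset.obj n) :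
    (f ≫ g).hom.app n x = g.hom.app n (f.hom.app n x) := rfl

/-- The quotient `X / A` of a simplicial set by a subcomplex `A`, pointed by the class of `A`
(a point `a` of `A` is supplied in each degree). -/
def collapse (X : SSet.{u}) (A : X.Subcomplex) (a : ∀ n, X.obj n) (ha : ∀ n, a n ∈ A.obj n) :
    PointedSSet.{u} where
  sset :=
    { obj n := Quot (fun x y : X.obj n => x ∈ A.obj n ∧ y ∈ A.obj n)
      map θ := ↾(Quot.map (X.map θ) (fun _ _ h => ⟨A.map θ h.1, A.map θ h.2⟩))
      map_id _ := by
        ext ⟨x⟩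
        exact congrArg (Quot.mk _) (by simp)
      map_comp θ θ' := by
        ext ⟨x⟩
        exact congrArg (Quot.mk _) (by simp) }
  pt n := Quot.mk _ (a n)
  map_pt θ := Quot.sound ⟨A.map θ (ha _), ha _⟩

/-- The quotient map `X ⟶ X / A`. -/
def collapseMk (X : SSet.{u}) (A : X.Subcomplex) (a : ∀ n, X.obj n) (ha : ∀ n, a n ∈ A.obj n) :
    X ⟶ (collapse X A a ha).sset where
  app _ := ↾(fun x => Quot.mk _ x)
  naturality _ _ _ := rfl

/-- A map out of `X` that is trivial on `A` factors through `X / A`. -/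
def collapseDesc {X : SSet.{u}} {A : X.Subcomplex} {a : ∀ n, X.obj n}
    {ha : ∀ n, a n ∈ A.obj n} {Y : PointedSSet.{u}} (f : X ⟶ Y.sset)
    (hf : ∀ n, ∀ x ∈ A.obj n, f.app n x = Y.pt n) : collapse X A a ha ⟶ Y where
  hom :=
    { app n := ↾(Quot.lift (f.app n) (fun x y h => (hf n x h.1).trans (hf n y h.2).symm))
      naturality _ _ θ := by
        ext ⟨x⟩
        exact NatTrans.naturality_apply f θ x }
  hom_pt n := hf n _ (ha n)

/-- The simplicial circle `S¹ = Δ[1] / ∂Δ[1]`. -/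
def circle : PointedSSet.{u} :=
  collapse Δ[1] (SSet.boundary 1) (fun n => SSet.stdSimplex.const 1 0 n) (fun n h => by
    obtain ⟨i, hi⟩ := h 1
    change (0 : Fin 2) = 1 at hi
    exact absurd hi (by decide))

/-- The wedge `A ∨ X` inside `A × X`. -/
def wedge (A X : PointedSSet.{u}) : (A.sset ⊗ X.sset).Subcomplex where
  obj n := {p | p.1 = A.pt n ∨ p.2 = X.pt n}
  map {m n} θ p hp := by
    rcases hp with hp | hp
    · exact Or.inl ((congrArg (A.sset.map θ) hp).trans (A.map_pt θ))
    · exact Or.inr ((congrArg (X.sset.map θ) hp).trans (X.map_pt θ))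

/-- The smash product `A ∧ X = (A × X) / (A ∨ X)`. -/
def smash (A X : PointedSSet.{u}) : PointedSSet.{u} :=
  collapse (A.sset ⊗ X.sset) (wedge A X) (fun n => (A.pt n, X.pt n)) (fun _ => Or.inl rfl)

/-- The class `a ∧ x` of a pair of simplices. -/
def smashMk {A X : PointedSSet.{u}} {n : SimplexCategoryᵒᵖ} (a : A.sset.obj n) (x : X.sset.obj n) :
    (smash A X).sset.obj n :=
  Quot.mk _ (a, x)


/-- A map out of `A × X` that is trivial on `A ∨ X` induces a map out of `A ∧ X`. -/
def smashDesc {A X Y : PointedSSet.{u}} (f : A.sset ⊗ X.sset ⟶ Y.sset)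
    (h₁ : ∀ n x, f.app n (A.pt n, x) = Y.pt n) (h₂ : ∀ n a, f.app n (a, X.pt n) = Y.pt n) :
    smash A X ⟶ Y :=
  collapseDesc f (fun n p hp => by
    obtain ⟨a, x⟩ := p
    rcases hp with hp | hp
    · obtain rfl : a = A.pt n := hp
      exact h₁ n x
    · obtain rfl : x = X.pt n := hp
      exact h₂ n a)

/-- Functoriality of the smash product in the second variable: `a ∧ x ↦ a ∧ f x`. -/
def smashMap (A : PointedSSet.{u}) {X Y : PointedSSet.{u}} (f : X ⟶ Y) : smash A X ⟶ smash A Y :=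
  collapseDesc ((A.sset ◁ f.hom) ≫ collapseMk _ _ _ _) (fun n p hp => by
    refine Quot.sound ⟨?_, Or.inl rfl⟩
    rcases hp with hp | hp
    · exact Or.inl hp
    · exact Or.inr ((congrArg (f.hom.app n) hp).trans (f.hom_pt n)))

lemma smash_ind {A X : PointedSSet.{u}} {n : SimplexCategoryᵒᵖ}
    {motive : (smash A X).sset.obj n → Prop} (h : ∀ a x, motive (smashMk a x)) (z) : motive z :=
  Quot.ind (fun p => h p.1 p.2) z

lemma smash_hom_ext {A X Y : PointedSSet.{u}} {f g : smash A X ⟶ Y}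
    (h : ∀ n a x, f.hom.app n (smashMk a x) = g.hom.app n (smashMk a x)) : f = g := by
  ext n z
  exact smash_ind (motive := fun z => f.hom.app n z = g.hom.app n z) (h n) z

@[simp] lemma smashDesc_mk {A X Y : PointedSSet.{u}} (f : A.sset ⊗ X.sset ⟶ Y.sset)
    (h₁ : ∀ n x, f.app n (A.pt n, x) = Y.pt n) (h₂ : ∀ n a, f.app n (a, X.pt n) = Y.pt n)
    {n} (a : A.sset.obj n) (x : X.sset.obj n) :
    (smashDesc f h₁ h₂).hom.app n (smashMk a x) = f.app n (a, x) := rfl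

@[simp] lemma smashMap_mk (A : PointedSSet.{u}) {X Y : PointedSSet.{u}} (f : X ⟶ Y)
    {n} (a : A.sset.obj n) (x : X.sset.obj n) :
    (smashMap A f).hom.app n (smashMk a x) = smashMk a (f.hom.app n x) := rfl

lemma smash_map_mk {A X : PointedSSet.{u}} {m n : SimplexCategoryᵒᵖ} (θ : m ⟶ n)
    (a : A.sset.obj m) (x : X.sset.obj m) :
    (smash A X).sset.map θ (smashMk a x) = smashMk (A.sset.map θ a) (X.sset.map θ x) := rfl

lemma smashMk_pt_left {A X : PointedSSet.{u}} {n} (x : X.sset.obj n) :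
    smashMk (A.pt n) x = (smash A X).pt n := Quot.sound ⟨Or.inl rfl, Or.inl rfl⟩

lemma smashMk_pt_right {A X : PointedSSet.{u}} {n} (a : A.sset.obj n) :
    smashMk a (X.pt n) = (smash A X).pt n := Quot.sound ⟨Or.inr rfl, Or.inl rfl⟩

end PointedSSet

open PointedSSet

/-! ### Spectra -/

/-- A (Bousfield–Friedlander) spectrum of simplicial sets: pointed simplicial sets `X₀, X₁, …`
with pointed structure maps `S¹ ∧ Xₖ ⟶ Xₖ₊₁`. -/
structure Spectrum : Type (u + 1) where
  level : ℕ → PointedSSet.{u}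
  str : ∀ k, smash circle (level k) ⟶ level (k + 1)

namespace Spectrum

/-- Maps of spectra: levelwise pointed maps that commute with the structure maps. -/
@[ext]
structure Hom (X Y : Spectrum.{u}) : Type u where
  level : ∀ k, X.level k ⟶ Y.level k
  comm : ∀ k, X.str k ≫ level (k + 1) = smashMap circle (level k) ≫ Y.str k

instance : Category Spectrum.{u} where
  Hom X Y := Hom X Y
  id X := ⟨fun k => 𝟙 (X.level k), fun k => smash_hom_ext fun _ _ _ => rfl⟩
  comp {X Y Z} f g := ⟨fun k => f.level k ≫ g.level k, fun k => by
    rw [← Category.assoc, f.comm, Category.assoc, g.comm]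
    exact smash_hom_ext fun _ _ _ => rfl⟩

/-- The set `(Xₖ)ₙ` of `n`-simplices of the `k`-th simplicial set of a spectrum. -/
abbrev Simplex (X : Spectrum.{u}) (k : ℕ) (n : SimplexCategoryᵒᵖ) : Type u :=
  (X.level k).sset.obj n

/-- The value of a map of spectra on a simplex. -/
def ap {X Y : Spectrum.{u}} (f : X ⟶ Y) {k : ℕ} {n : SimplexCategoryᵒᵖ} (x : X.Simplex k n) :
    Y.Simplex k n :=
  (Hom.level f k).hom.app n x

/-- The value of the structure map `S¹ ∧ Xₖ ⟶ Xₖ₊₁` on `t ∧ x`. -/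
def sus (X : Spectrum.{u}) {k : ℕ} {n : SimplexCategoryᵒᵖ} (t : (circle.{u}).sset.obj n)
    (x : X.Simplex k n) : X.Simplex (k + 1) n :=
  (X.str k).hom.app n (smashMk t x)

@[ext]
lemma hom_ext {X Y : Spectrum.{u}} {f g : X ⟶ Y}
    (h : ∀ k n (x : X.Simplex k n), ap f x = ap g x) : f = g := by
  apply Hom.ext
  funext k
  ext n x
  exact h k n x

@[simp] lemma ap_id {X : Spectrum.{u}} {k n} (x : X.Simplex k n) : ap (𝟙 X) x = x := rfl

@[simp] lemma ap_comp {X Y Z : Spectrum.{u}} (f : X ⟶ Y) (g : Y ⟶ Z) {k n} (x : X.Simplex k n) :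
    ap (f ≫ g) x = ap g (ap f x) := rfl

lemma ap_pt {X Y : Spectrum.{u}} (f : X ⟶ Y) (k n) :
    ap f ((X.level k).pt n) = (Y.level k).pt n := (Hom.level f k).hom_pt n

lemma ap_map {X Y : Spectrum.{u}} (f : X ⟶ Y) {k m n} (θ : m ⟶ n) (x : X.Simplex k m) :
    ap f ((X.level k).sset.map θ x) = (Y.level k).sset.map θ (ap f x) :=
  NatTrans.naturality_apply (Hom.level f k).hom θ x

lemma ap_sus {X Y : Spectrum.{u}} (f : X ⟶ Y) {k n} (t : (circle.{u}).sset.obj n)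
    (x : X.Simplex k n) : ap f (X.sus t x) = Y.sus t (ap f x) :=
  congrArg (fun φ : smash circle (X.level k) ⟶ Y.level (k + 1) => φ.hom.app n (smashMk t x))
    (Hom.comm f k)

lemma map_sus (X : Spectrum.{u}) {k m n} (θ : m ⟶ n) (t : (circle.{u}).sset.obj m)
    (x : X.Simplex k m) : (X.level (k + 1)).sset.map θ (X.sus t x) =
      X.sus ((circle.{u}).sset.map θ t) ((X.level k).sset.map θ x) :=
  (NatTrans.naturality_apply (X.str k).hom θ (smashMk t x)).symm

lemma sus_pt_left (X : Spectrum.{u}) {k n} (x : X.Simplex k n) :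
    X.sus ((circle.{u}).pt n) x = (X.level (k + 1)).pt n :=
  (congrArg _ (smashMk_pt_left x)).trans ((X.str k).hom_pt n)

lemma sus_pt_right (X : Spectrum.{u}) {k n} (t : (circle.{u}).sset.obj n) :
    X.sus t ((X.level k).pt n) = (X.level (k + 1)).pt n :=
  (congrArg _ (smashMk_pt_right t)).trans ((X.str k).hom_pt n)

/-- Constructor for a structure map `S¹ ∧ X ⟶ Y` from its values on the classes `t ∧ x`. -/
def strMk {X Y : PointedSSet.{u}}
    (s : ∀ n, (circle.{u}).sset.obj n → X.sset.obj n → Y.sset.obj n)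
    (s_map : ∀ {m n} (θ : m ⟶ n) t x,
      Y.sset.map θ (s m t x) = s n ((circle.{u}).sset.map θ t) (X.sset.map θ x))
    (s_left : ∀ n x, s n ((circle.{u}).pt n) x = Y.pt n)
    (s_right : ∀ n t, s n t (X.pt n) = Y.pt n) : smash circle X ⟶ Y :=
  smashDesc
    { app n := ↾(fun p => s n p.1 p.2)
      naturality _ _ θ := by
        ext ⟨t, x⟩
        exact (s_map θ t x).symm } s_left s_right

/-- Constructor for maps of spectra from their values on simplices. -/
def homMk {X Y : Spectrum.{u}} (f : ∀ k n, X.Simplex k n → Y.Simplex k n)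
    (f_map : ∀ {k m n} (θ : m ⟶ n) (x : X.Simplex k m),
      f k n ((X.level k).sset.map θ x) = (Y.level k).sset.map θ (f k m x))
    (f_pt : ∀ k n, f k n ((X.level k).pt n) = (Y.level k).pt n)
    (f_sus : ∀ {k n} (t : (circle.{u}).sset.obj n) (x : X.Simplex k n),
      f (k + 1) n (X.sus t x) = Y.sus t (f k n x)) : X ⟶ Y :=
  Hom.mk
    (fun k =>
      { hom :=
          { app n := ↾(f k n)
            naturality _ _ θ := by
              ext x
              exact f_map θ x }
        hom_pt := f_pt k })
    (fun _ => smash_hom_ext fun _ t x => f_sus t x)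

@[simp] lemma ap_homMk {X Y : Spectrum.{u}} (f : ∀ k n, X.Simplex k n → Y.Simplex k n)
    (f_map f_pt f_sus) {k n} (x : X.Simplex k n) :
    ap (homMk (X := X) (Y := Y) f f_map f_pt f_sus) x = f k n x := rfl

/-! ### Subspectra, products, equalizers -/

/-- A subspectrum of `X`. -/
structure Sub (X : Spectrum.{u}) where
  carrier : ∀ k n, Set (X.Simplex k n)
  map_mem : ∀ {k m n} (θ : m ⟶ n) {x}, x ∈ carrier k m → (X.level k).sset.map θ x ∈ carrier k n
  pt_mem : ∀ k n, (X.level k).pt n ∈ carrier k n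
  sus_mem : ∀ {k n} (t : (circle.{u}).sset.obj n) {x}, x ∈ carrier k n →
    X.sus t x ∈ carrier (k + 1) n

namespace Sub

variable {X Y : Spectrum.{u}}

/-- A subspectrum, regarded as a spectrum. -/
def toSpectrum (A : Sub X) : Spectrum.{u} where
  level k :=
    { sset :=
        { obj n := A.carrier k n
          map θ := ↾(fun x => ⟨(X.level k).sset.map θ x.1, A.map_mem θ x.2⟩)
          map_id _ := types_ext fun x => Subtype.ext (sset_map_id x.1)
          map_comp θ θ' := types_ext fun x => Subtype.ext (sset_map_comp θ θ' x.1) }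
      pt n := ⟨(X.level k).pt n, A.pt_mem k n⟩
      map_pt θ := Subtype.ext ((X.level k).map_pt θ) }
  str _ := strMk (fun _ t x => ⟨X.sus t x.1, A.sus_mem t x.2⟩)
    (fun θ t x => Subtype.ext (X.map_sus θ t x.1))
    (fun _ x => Subtype.ext (X.sus_pt_left x.1))
    (fun _ t => Subtype.ext (X.sus_pt_right t))

/-- The inclusion of a subspectrum. -/
def ι (A : Sub X) : A.toSpectrum ⟶ X :=
  homMk (fun _ _ x => x.1) (fun _ _ => rfl) (fun _ _ => rfl) (fun _ _ => rfl)

/-- A map of spectra with values in a subspectrum. -/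
def lift (A : Sub X) (f : Y ⟶ X) (hf : ∀ k n (y : Y.Simplex k n), ap f y ∈ A.carrier k n) :
    Y ⟶ A.toSpectrum :=
  homMk (fun k n y => ⟨ap f y, hf k n y⟩) (fun θ y => Subtype.ext (ap_map f θ y))
    (fun k n => Subtype.ext (ap_pt f k n)) (fun t y => Subtype.ext (ap_sus f t y))

@[simp] lemma lift_ι (A : Sub X) (f : Y ⟶ X) (hf) : A.lift f hf ≫ A.ι = f := rfl

lemma ι_injective (A : Sub X) {f g : Y ⟶ A.toSpectrum} (h : f ≫ A.ι = g ≫ A.ι) : f = g := by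
  ext k n y
  exact Subtype.ext (congrArg (fun φ : Y ⟶ X => ap φ y) h)

end Sub

/-- The product of a family of spectra, formed in each level and each simplicial degree. -/
def prod {I : Type u} (X : I → Spectrum.{u}) : Spectrum.{u} where
  level k :=
    { sset :=
        { obj n := ∀ i, (X i).Simplex k n
          map θ := ↾(fun x i => ((X i).level k).sset.map θ (x i))
          map_id _ := types_ext fun x => funext fun i => sset_map_id (x i)
          map_comp θ θ' := types_ext fun x => funext fun i => sset_map_comp θ θ' (x i) }
      pt n := fun i => ((X i).level k).pt n
      map_pt θ := funext fun i => ((X i).level k).map_pt θ }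
  str _ := strMk (fun _ t x i => (X i).sus t (x i))
    (fun θ t x => funext fun i => (X i).map_sus θ t (x i))
    (fun _ x => funext fun i => (X i).sus_pt_left (x i))
    (fun _ t => funext fun i => (X i).sus_pt_right t)

/-- The projections of a product. -/
def prodπ {I : Type u} (X : I → Spectrum.{u}) (i : I) : prod X ⟶ X i :=
  homMk (fun _ _ x => x i) (fun _ _ => rfl) (fun _ _ => rfl) (fun _ _ => rfl)

/-- The map into a product with given components. -/
def prodLift {I : Type u} {X : I → Spectrum.{u}} {Y : Spectrum.{u}} (f : ∀ i, Y ⟶ X i) :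
    Y ⟶ prod X :=
  homMk (fun _ _ y i => ap (f i) y) (fun θ y => funext fun i => ap_map (f i) θ y)
    (fun k n => funext fun i => ap_pt (f i) k n) (fun t y => funext fun i => ap_sus (f i) t y)

@[simp] lemma prodLift_π {I : Type u} {X : I → Spectrum.{u}} {Y : Spectrum.{u}}
    (f : ∀ i, Y ⟶ X i) (i : I) : prodLift f ≫ prodπ X i = f i := rfl

@[ext]
lemma prod_hom_ext {I : Type u} {X : I → Spectrum.{u}} {Y : Spectrum.{u}} {f g : Y ⟶ prod X}
    (h : ∀ i, f ≫ prodπ X i = g ≫ prodπ X i) : f = g := by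
  apply hom_ext
  intro k n y
  exact funext fun i => congrArg (fun φ : Y ⟶ X i => ap φ y) (h i)

/-- `prod X` is the categorical product. -/
def prodIsLimit {I : Type u} (X : I → Spectrum.{u}) :
    Limits.IsLimit (Limits.Fan.mk (prod X) (prodπ X)) :=
  Limits.Fan.IsLimit.mk _ (fun s => prodLift s.proj) (fun _ i => prodLift_π _ i)
    (fun _ _ h => prod_hom_ext fun i => h i)

/-- The equalizer of two maps of spectra, as a subspectrum of the source. -/
def eqSub {X Y : Spectrum.{u}} (f g : X ⟶ Y) : Sub X where
  carrier _ _ := {x | ap f x = ap g x}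
  map_mem θ x hx := by
    change ap f _ = ap g _
    rw [ap_map, ap_map]
    exact congrArg _ hx
  pt_mem k n := (ap_pt f k n).trans (ap_pt g k n).symm
  sus_mem t x hx := by
    change ap f _ = ap g _
    rw [ap_sus, ap_sus]
    exact congrArg _ hx

lemma eqSub_condition {X Y : Spectrum.{u}} (f g : X ⟶ Y) :
    (eqSub f g).ι ≫ f = (eqSub f g).ι ≫ g := by
  ext k n x
  exact x.2

/-- The universal property of the equalizer. -/
def eqLift {X Y W : Spectrum.{u}} {f g : X ⟶ Y} (h : W ⟶ X) (w : h ≫ f = h ≫ g) :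
    W ⟶ (eqSub f g).toSpectrum :=
  (eqSub f g).lift h (fun _ _ y => congrArg (fun φ : W ⟶ Y => ap φ y) w)

/-- `eqSub f g` is the categorical equalizer. -/
def eqIsLimit {X Y : Spectrum.{u}} (f g : X ⟶ Y) :
    Limits.IsLimit (Limits.Fork.ofι (eqSub f g).ι (eqSub_condition f g)) :=
  Limits.Fork.IsLimit.mk _ (fun s => eqLift s.ι s.condition) (fun _ => rfl)
    (fun _ _ h => (eqSub f g).ι_injective h)

/-! ### Cotensors and homotopy limits -/

/-- The simplicial mapping space: its `n`-simplices are the maps `Δ[n] × K ⟶ Y`. -/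
def mapSSet (K Y : SSet.{u}) : SSet.{u} where
  obj n := SSet.stdSimplex.obj n.unop ⊗ K ⟶ Y
  map θ := ↾(fun f => (SSet.stdSimplex.map θ.unop ▷ K) ≫ f)
  map_id n := types_ext fun f =>
    (congrArg (fun h => (h ▷ K) ≫ f) (CategoryTheory.Functor.map_id SSet.stdSimplex n.unop)).trans rfl
  map_comp θ θ' := types_ext fun f =>
    (congrArg (fun h => (h ▷ K) ≫ f)
      (CategoryTheory.Functor.map_comp SSet.stdSimplex θ'.unop θ.unop)).trans rfl

/-- The constant map at the base point. -/
def mapPt (A : SSet.{u}) (Y : PointedSSet.{u}) : A ⟶ Y.sset where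
  app n := ↾(fun _ => Y.pt n)
  naturality _ _ θ := types_ext fun _ => (Y.map_pt θ).symm

/-- The operator `n ⟶ m` that corresponds to an `m`-simplex of `Δ[n]`. -/
def operator {n m : SimplexCategoryᵒᵖ} (a : (SSet.stdSimplex.{u}.obj n.unop).obj m) : n ⟶ m :=
  (SSet.stdSimplex.objEquiv a).op

/-- The structure map of a cotensor sends `t ∧ f`, where `f : Δ[n] × K ⟶ Xₖ`, to the map
`Δ[n] × K ⟶ Xₖ₊₁`, `(a, y) ↦ σ (a^* t ∧ f (a, y))`. -/
def mapSus (X : Spectrum.{u}) (K : SSet.{u}) {k : ℕ} {n : SimplexCategoryᵒᵖ}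
    (t : (circle.{u}).sset.obj n) (f : SSet.stdSimplex.obj n.unop ⊗ K ⟶ (X.level k).sset) :
    SSet.stdSimplex.obj n.unop ⊗ K ⟶ (X.level (k + 1)).sset where
  app m := ↾(fun p => X.sus ((circle.{u}).sset.map (operator p.1) t) (f.app m p))
  naturality m m' θ := types_ext fun p => by
    refine Eq.trans ?_ (X.map_sus θ _ _).symm
    refine congrArg₂ X.sus ?_ (NatTrans.naturality_apply f θ p)
    rw [← sset_map_comp]
    rfl

/-- The cotensor `X^K` of a spectrum with a simplicial set: `(X^K)ₖ` is the pointed simplicial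
mapping space from `K` to `Xₖ`. -/
def cotensor (X : Spectrum.{u}) (K : SSet.{u}) : Spectrum.{u} where
  level k :=
    { sset := mapSSet K (X.level k).sset
      pt n := mapPt _ (X.level k)
      map_pt _ := rfl }
  str k := strMk (fun n t f => mapSus X K t f)
    (fun {m n} θ t f => by
      refine NatTrans.ext (funext fun l => types_ext fun p => ?_)
      change X.sus ((circle.{u}).sset.map (operator _) t) _ =
        X.sus ((circle.{u}).sset.map (operator p.1) ((circle.{u}).sset.map θ t)) _
      rw [← sset_map_comp]
      rfl)
    (fun n f => NatTrans.ext (funext fun l => types_ext fun p => by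
      change X.sus ((circle.{u}).sset.map (operator p.1) _) _ = _
      rw [(circle.{u}).map_pt]
      exact X.sus_pt_left _))
    (fun n t => NatTrans.ext (funext fun l => types_ext fun p => X.sus_pt_right _))

/-- Functoriality of the cotensor in the spectrum. -/
def cotensorMap {X Y : Spectrum.{u}} (φ : X ⟶ Y) (K : SSet.{u}) : cotensor X K ⟶ cotensor Y K :=
  homMk (fun k _ f => f ≫ (Hom.level φ k).hom) (fun _ _ => rfl)
    (fun k _ => NatTrans.ext (funext fun l => types_ext fun _ => ap_pt φ k l))
    (fun _ _ => NatTrans.ext (funext fun _ => types_ext fun _ => ap_sus φ _ _))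

/-- Functoriality of the cotensor in the simplicial set. -/
def cotensorPre (X : Spectrum.{u}) {K L : SSet.{u}} (j : K ⟶ L) : cotensor X L ⟶ cotensor X K :=
  homMk (fun _ n f => (SSet.stdSimplex.obj n.unop ◁ j) ≫ f) (fun _ _ => rfl)
    (fun _ _ => rfl) (fun _ _ => rfl)

lemma cotensorMap_id (X : Spectrum.{u}) (K : SSet.{u}) : cotensorMap (𝟙 X) K = 𝟙 _ := rfl

lemma cotensorMap_comp {X Y Z : Spectrum.{u}} (φ : X ⟶ Y) (ψ : Y ⟶ Z) (K : SSet.{u}) :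
    cotensorMap (φ ≫ ψ) K = cotensorMap φ K ≫ cotensorMap ψ K := rfl

lemma cotensorMap_pre {X Y : Spectrum.{u}} (φ : X ⟶ Y) {K L : SSet.{u}} (j : K ⟶ L) :
    cotensorMap φ L ≫ cotensorPre Y j = cotensorPre X j ≫ cotensorMap φ K := rfl

section Holim

variable {C : Type u} [SmallCategory C]

/-- The classifying space `B(C ↓ c)` of the category of objects over `c`. -/
abbrev overNerve (c : C) : SSet.{u} := nerve (Over c)

/-- The map `B(C ↓ c) ⟶ B(C ↓ d)` induced by `σ : c ⟶ d`. -/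
abbrev overNerveMap {c d : C} (σ : c ⟶ d) : overNerve c ⟶ overNerve d := nerveMap (Over.map σ)

/-- `∏_c X(c)^{B(C ↓ c)}`. -/
def holimSource (X : C ⥤ Spectrum.{u}) : Spectrum.{u} :=
  prod fun c : C => cotensor (X.obj c) (overNerve c)

/-- `∏_{σ : c ⟶ d} X(d)^{B(C ↓ c)}`. -/
def holimTarget (X : C ⥤ Spectrum.{u}) : Spectrum.{u} :=
  prod fun σ : Arrow C => cotensor (X.obj σ.right) (overNerve σ.left)

/-- The map `α`, with components `X(σ)^{B(C ↓ c)}`. -/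
def holimα (X : C ⥤ Spectrum.{u}) : holimSource X ⟶ holimTarget X :=
  prodLift fun σ : Arrow C =>
    prodπ (fun c : C => cotensor (X.obj c) (overNerve c)) σ.left ≫
      cotensorMap (X.map σ.hom) (overNerve σ.left)

/-- The map `β`, with components `X(d)^{B(C ↓ σ)}`. -/
def holimβ (X : C ⥤ Spectrum.{u}) : holimSource X ⟶ holimTarget X :=
  prodLift fun σ : Arrow C =>
    prodπ (fun c : C => cotensor (X.obj c) (overNerve c)) σ.right ≫
      cotensorPre (X.obj σ.right) (overNerveMap σ.hom)

/-- The homotopy limit of a diagram of spectra: the equalizer of `α` and `β`. -/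
def holim (X : C ⥤ Spectrum.{u}) : Spectrum.{u} :=
  (eqSub (holimα X) (holimβ X)).toSpectrum

/-- The inclusion of the homotopy limit into `∏_c X(c)^{B(C ↓ c)}`. -/
def holimι (X : C ⥤ Spectrum.{u}) : holim X ⟶ holimSource X :=
  (eqSub (holimα X) (holimβ X)).ι

/-- The map `∏_c X(c)^{B(C ↓ c)} ⟶ ∏_c Y(c)^{B(C ↓ c)}` induced by a map of diagrams. -/
def holimSourceMap {X Y : C ⥤ Spectrum.{u}} (η : X ⟶ Y) : holimSource X ⟶ holimSource Y :=
  prodLift fun c : C => prodπ (fun c : C => cotensor (X.obj c) (overNerve c)) c ≫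
    cotensorMap (η.app c) (overNerve c)

/-- The map of homotopy limits induced by a map of diagrams. -/
def holimMap {X Y : C ⥤ Spectrum.{u}} (η : X ⟶ Y) : holim X ⟶ holim Y :=
  eqLift (holimι X ≫ holimSourceMap η) (by
    refine prod_hom_ext fun σ => ?_
    have h : holimι X ≫ holimα X ≫ prodπ _ σ = holimι X ≫ holimβ X ≫ prodπ _ σ :=
      congrArg (fun φ => φ ≫ prodπ _ σ) (eqSub_condition (holimα X) (holimβ X))
    have h' := congrArg (fun φ => φ ≫ cotensorMap (η.app σ.right) (overNerve σ.left)) h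
    have hn := η.naturality σ.hom
    refine Eq.trans ?_ (h'.trans ?_)
    · change (holimι X ≫ prodπ _ σ.left) ≫
          cotensorMap (η.app σ.left ≫ Y.map σ.hom) (overNerve σ.left) =
        (holimι X ≫ prodπ _ σ.left) ≫
          cotensorMap (X.map σ.hom ≫ η.app σ.right) (overNerve σ.left)
      rw [hn]
    · rfl)

/-- The homotopy limit as a functor of the diagram. -/
def holimFunctor (C : Type u) [SmallCategory C] : (C ⥤ Spectrum.{u}) ⥤ Spectrum.{u} where
  obj X := holim X
  map η := holimMap η
  map_id _ := rfl
  map_comp _ _ := rfl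

end Holim

end Spectrum

open Spectrum

/-! ### `G`-spectra and discrete `G`-spectra -/

/-- A `G`-spectrum: a spectrum with a (left) action of `G` by maps of spectra. -/
abbrev GSpectrum (G : Type u) [Group G] : Type (u + 1) := Action Spectrum.{u} G

namespace GSpectrum

section Action

variable {G : Type u} [Group G]

/-- The action of `g` on a simplex of a `G`-spectrum. -/
def act (Y : GSpectrum G) (g : G) {k : ℕ} {n : SimplexCategoryᵒᵖ} (y : Y.V.Simplex k n) :
    Y.V.Simplex k n :=
  ap (X := Y.V) (Y := Y.V) (Y.ρ g) y

lemma act_one (Y : GSpectrum G) {k n} (y : Y.V.Simplex k n) : Y.act 1 y = y :=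
  congrArg (fun φ : Y.V ⟶ Y.V => ap φ y) (map_one Y.ρ)

lemma act_mul (Y : GSpectrum G) (g h : G) {k n} (y : Y.V.Simplex k n) :
    Y.act (g * h) y = Y.act g (Y.act h y) :=
  congrArg (fun φ : Y.V ⟶ Y.V => ap φ y) (map_mul Y.ρ g h)

lemma act_pt (Y : GSpectrum G) (g : G) (k n) :
    Y.act g ((Y.V.level k).pt n) = (Y.V.level k).pt n :=
  ap_pt (X := Y.V) (Y := Y.V) (Y.ρ g) k n

lemma act_map (Y : GSpectrum G) (g : G) {k m n} (θ : m ⟶ n) (y : Y.V.Simplex k m) :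
    Y.act g ((Y.V.level k).sset.map θ y) = (Y.V.level k).sset.map θ (Y.act g y) :=
  ap_map (X := Y.V) (Y := Y.V) (Y.ρ g) θ y

lemma act_sus (Y : GSpectrum G) (g : G) {k n} (t : (circle.{u}).sset.obj n)
    (y : Y.V.Simplex k n) : Y.act g (Y.V.sus t y) = Y.V.sus t (Y.act g y) :=
  ap_sus (X := Y.V) (Y := Y.V) (Y.ρ g) t y

lemma ap_act {Y Z : GSpectrum G} (φ : Y ⟶ Z) (g : G) {k n} (y : Y.V.Simplex k n) :
    ap φ.hom (Y.act g y) = Z.act g (ap φ.hom y) :=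
  congrArg (fun ψ : Y.V ⟶ Z.V => ap ψ y) (φ.comm g)

/-- The fixed point spectrum `Y^H` of a subgroup `H`. -/
def fixedPoints (Y : GSpectrum G) (H : Subgroup G) : Sub Y.V where
  carrier _ _ := {y | ∀ h ∈ H, Y.act h y = y}
  map_mem θ y hy h hh := by rw [act_map, hy h hh]
  pt_mem k n h _ := Y.act_pt h k n
  sus_mem t y hy h hh := by rw [act_sus, hy h hh]

/-- The homotopy limit, formed in spectra, of a diagram of `G`-spectra is a `G`-spectrum:
`g` acts through the automorphisms of the `X(c)`. -/
def holim {C : Type u} [SmallCategory C] (X : C ⥤ GSpectrum G) : GSpectrum G where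
  V := Spectrum.holim (X ⋙ Action.forget Spectrum.{u} G)
  ρ :=
    { toFun g := holimMap
        { app c := (X.obj c).ρ g
          naturality _ _ σ := ((X.map σ).comm g).symm }
      map_one' := by
        refine Eq.trans (congrArg holimMap (NatTrans.ext (funext fun c => ?_)))
          ((holimFunctor C).map_id _)
        exact map_one (X.obj c).ρ
      map_mul' g h := by
        refine Eq.trans (congrArg holimMap (NatTrans.ext (funext fun c => ?_)))
          ((holimFunctor C).map_comp
            (X := X ⋙ Action.forget Spectrum.{u} G)
            (Y := X ⋙ Action.forget Spectrum.{u} G)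
            (Z := X ⋙ Action.forget Spectrum.{u} G)
            { app c := (X.obj c).ρ h
              naturality _ _ σ := ((X.map σ).comm h).symm }
            { app c := (X.obj c).ρ g
              naturality _ _ σ := ((X.map σ).comm g).symm })
        exact map_mul (X.obj c).ρ g h }

end Action

variable {G : Type u} [Group G] [TopologicalSpace G]

/-- A `G`-spectrum is discrete if the action maps `G × (Yₖ)ₙ ⟶ (Yₖ)ₙ` are continuous, where
`(Yₖ)ₙ` has the discrete topology. -/
def isDiscrete (G : Type u) [Group G] [TopologicalSpace G] : ObjectProperty (GSpectrum G) :=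
  fun Y => ∀ k n, letI : TopologicalSpace (Y.V.Simplex k n) := ⊥
    Continuous (fun p : G × Y.V.Simplex k n => Y.act p.1 p.2)

/-- The spectrum `colim_N Y^N`, where `N` runs over the open normal subgroups of `G`, realised as
the union of the subspectra `Y^N` of `Y`; see `colimFixedIsColimit`. -/
def colimFixedSub (Y : GSpectrum G) : Sub Y.V where
  carrier k n := ⋃ N : OpenNormalSubgroup G, (Y.fixedPoints N.toSubgroup).carrier k n
  map_mem θ y hy := by
    obtain ⟨N, hN⟩ := Set.mem_iUnion.1 hy
    exact Set.mem_iUnion.2 ⟨N, (Y.fixedPoints N.toSubgroup).map_mem θ hN⟩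
  pt_mem k n := Set.mem_iUnion.2
    ⟨{ toSubgroup := ⊤, isOpen' := isOpen_univ, isNormal' := inferInstance },
      (Y.fixedPoints ⊤).pt_mem k n⟩
  sus_mem t y hy := by
    obtain ⟨N, hN⟩ := Set.mem_iUnion.1 hy
    exact Set.mem_iUnion.2 ⟨N, (Y.fixedPoints N.toSubgroup).sus_mem t hN⟩

/-- The diagram `N ↦ Y^N` of fixed point spectra, with the inclusions `Y^N ⟶ Y^{N'}` for
`N' ≤ N`. -/
def fixedDiagram (Y : GSpectrum G) : (OpenNormalSubgroup G)ᵒᵖ ⥤ Spectrum.{u} where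
  obj N := (Y.fixedPoints N.unop.toSubgroup).toSpectrum
  map {N N'} i := (Y.fixedPoints N'.unop.toSubgroup).lift (Y.fixedPoints N.unop.toSubgroup).ι
    (fun _ _ y h hh => y.2 h (leOfHom i.unop hh))
  map_id _ := rfl
  map_comp _ _ := rfl

/-- The inclusions of the `Y^N` into their union. -/
def colimFixedCocone (Y : GSpectrum G) : Limits.Cocone (fixedDiagram Y) where
  pt := (colimFixedSub Y).toSpectrum
  ι :=
    { app N := (colimFixedSub Y).lift (Y.fixedPoints N.unop.toSubgroup).ι
        (fun _ _ y => Set.mem_iUnion.2 ⟨N.unop, y.2⟩)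
      naturality _ _ _ := rfl }

/-- A leg of a cocone under `N ↦ Y^N`. -/
def leg {Y : GSpectrum G} (s : Limits.Cocone (fixedDiagram Y)) (N : OpenNormalSubgroup G) :
    (Y.fixedPoints N.toSubgroup).toSpectrum ⟶ s.pt :=
  s.ι.app (op N)

lemma leg_eq {Y : GSpectrum G} (s : Limits.Cocone (fixedDiagram Y)) {k n}
    (y : Y.V.Simplex k n) {N N' : OpenNormalSubgroup G}
    (h : y ∈ (Y.fixedPoints N.toSubgroup).carrier k n)
    (h' : y ∈ (Y.fixedPoints N'.toSubgroup).carrier k n) :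
    ap (leg s N) (k := k) (n := n) ⟨y, h⟩ = ap (leg s N') (k := k) (n := n) ⟨y, h'⟩ := by
  have e₁ : (fixedDiagram Y).map (homOfLE (inf_le_left : N ⊓ N' ≤ N)).op ≫ leg s (N ⊓ N') =
    leg s N := s.w _
  have e₂ : (fixedDiagram Y).map (homOfLE (inf_le_right : N ⊓ N' ≤ N')).op ≫ leg s (N ⊓ N') =
    leg s N' := s.w _
  rw [← e₁, ← e₂]
  rfl

/-- The map out of the union induced by a cocone, on simplices. -/
def descFun {Y : GSpectrum G} (s : Limits.Cocone (fixedDiagram Y)) {k n}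
    (y : (colimFixedSub Y).toSpectrum.Simplex k n) : s.pt.Simplex k n :=
  ap (leg s (Set.mem_iUnion.1 y.2).choose) (k := k) (n := n)
    ⟨y.1, (Set.mem_iUnion.1 y.2).choose_spec⟩

lemma descFun_eq {Y : GSpectrum G} (s : Limits.Cocone (fixedDiagram Y)) {k n}
    (y : (colimFixedSub Y).toSpectrum.Simplex k n) (N : OpenNormalSubgroup G)
    (h : y.1 ∈ (Y.fixedPoints N.toSubgroup).carrier k n) :
    descFun s y = ap (leg s N) (k := k) (n := n) ⟨y.1, h⟩ :=
  leg_eq s _ _ _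

/-- The map out of the union induced by a cocone. -/
def colimFixedDesc {Y : GSpectrum G} (s : Limits.Cocone (fixedDiagram Y)) :
    (colimFixedSub Y).toSpectrum ⟶ s.pt :=
  homMk (fun _ _ y => descFun s y)
    (fun {k m n} θ y => by
      obtain ⟨N, hN⟩ := Set.mem_iUnion.1 y.2
      exact (descFun_eq s _ N ((Y.fixedPoints N.toSubgroup).map_mem θ hN)).trans
        ((ap_map (leg s N) θ (⟨y.1, hN⟩ :
          (Y.fixedPoints N.toSubgroup).toSpectrum.Simplex k m)).trans
        (congrArg _ (descFun_eq s y N hN).symm)))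
    (fun k n => by
      obtain ⟨N, -⟩ := Set.mem_iUnion.1 ((colimFixedSub Y).pt_mem k n)
      exact (descFun_eq s _ N ((Y.fixedPoints N.toSubgroup).pt_mem k n)).trans
        (ap_pt (leg s N) k n))
    (fun {k n} t y => by
      obtain ⟨N, hN⟩ := Set.mem_iUnion.1 y.2
      exact (descFun_eq s _ N ((Y.fixedPoints N.toSubgroup).sus_mem t hN)).trans
        ((ap_sus (leg s N) t (⟨y.1, hN⟩ :
          (Y.fixedPoints N.toSubgroup).toSpectrum.Simplex k n)).trans
        (congrArg _ (descFun_eq s y N hN).symm)))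

/-- The union of the `Y^N` is their colimit in the category of spectra. -/
def colimFixedIsColimit (Y : GSpectrum G) : Limits.IsColimit (colimFixedCocone Y) where
  desc s := colimFixedDesc s
  fac s N := Spectrum.hom_ext fun k n y =>
    descFun_eq s (ap ((colimFixedCocone Y).ι.app N) y) N.unop y.2
  uniq s f hf := Spectrum.hom_ext fun k n y => by
    obtain ⟨N, hN⟩ := Set.mem_iUnion.1 y.2
    refine Eq.trans ?_ (descFun_eq s y N hN).symm
    exact congrArg (fun φ => ap φ (k := k) (n := n)
      (⟨y.1, hN⟩ : (Y.fixedPoints N.toSubgroup).toSpectrum.Simplex k n)) (hf (op N))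

lemma act_mem_colimFixed (Y : GSpectrum G) (g : G) {k n} {y : Y.V.Simplex k n}
    (hy : y ∈ (colimFixedSub Y).carrier k n) : Y.act g y ∈ (colimFixedSub Y).carrier k n := by
  obtain ⟨N, hN⟩ := Set.mem_iUnion.1 hy
  refine Set.mem_iUnion.2 ⟨N, fun h hh => ?_⟩
  have hc : g⁻¹ * h * g ∈ N.toSubgroup := by
    simpa using N.isNormal'.conj_mem h hh g⁻¹
  rw [← act_mul, show h * g = g * (g⁻¹ * h * g) by group, act_mul, hN _ hc]

/-- `colim_N Y^N` as a `G`-spectrum; the action is the one for which `Y^N ⟶ colim_N Y^N` is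
equivariant for every `N`. -/
def colimFixedG (Y : GSpectrum G) : GSpectrum G where
  V := (colimFixedSub Y).toSpectrum
  ρ :=
    { toFun g := (colimFixedSub Y).lift ((colimFixedSub Y).ι ≫ Y.ρ g)
        (fun _ _ y => Y.act_mem_colimFixed g y.2)
      map_one' := by
        apply Spectrum.hom_ext
        intro k n y
        exact Subtype.ext (Y.act_one y.1)
      map_mul' g h := by
        apply Spectrum.hom_ext
        intro k n y
        exact Subtype.ext (Y.act_mul g h y.1) }

lemma isDiscrete_colimFixedG [IsTopologicalGroup G] (Y : GSpectrum G) :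
    isDiscrete G Y.colimFixedG := by
  intro k n
  let _ : TopologicalSpace (Y.colimFixedG.V.Simplex k n) := ⊥
  have _ : DiscreteTopology (Y.colimFixedG.V.Simplex k n) := ⟨rfl⟩
  rw [continuous_prod_of_discrete_right]
  intro y
  obtain ⟨N, hN⟩ := Set.mem_iUnion.1 y.2
  refine continuous_discrete_rng.2 fun z => isOpen_iff_mem_nhds.2 fun g hg => ?_
  have hopen : IsOpen ((fun x : G => g⁻¹ * x) ⁻¹' (N.toSubgroup : Set G)) :=
    N.isOpen'.preimage (continuous_const_mul g⁻¹)
  refine Filter.mem_of_superset (hopen.mem_nhds (by simp)) fun x hx => ?_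
  refine Eq.trans (Subtype.ext ?_) (Set.mem_singleton_iff.1 hg)
  change Y.act x y.1 = Y.act g y.1
  rw [show x = g * (g⁻¹ * x) by group, act_mul, hN _ hx]

end GSpectrum

/-- The category of discrete `G`-spectra and `G`-equivariant maps of spectra. -/
abbrev DiscreteGSpectrum (G : Type u) [Group G] [TopologicalSpace G] : Type (u + 1) :=
  (GSpectrum.isDiscrete G).FullSubcategory

/-- The discrete `G`-spectrum `colim_N Y^N` of a `G`-spectrum `Y`. -/
def GSpectrum.colimFixed {G : Type u} [Group G] [TopologicalSpace G] [IsTopologicalGroup G]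
    (Y : GSpectrum G) : DiscreteGSpectrum G :=
  ⟨Y.colimFixedG, Y.isDiscrete_colimFixedG⟩

/-- The homotopy limit, formed in spectra, of a diagram of discrete `G`-spectra. It is a
`G`-spectrum, but need not be discrete. -/
def DiscreteGSpectrum.holim {G : Type u} [Group G] [TopologicalSpace G] {C : Type u}
    [SmallCategory C] (X : C ⥤ DiscreteGSpectrum G) : GSpectrum G :=
  GSpectrum.holim (X ⋙ (GSpectrum.isDiscrete G).ι)

/-! ### The site of finite discrete `G`-sets -/

/-- The category of finite discrete `G`-sets: finite sets with a continuous action of `G`. -/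
abbrev FinGSet (G : Type u) [Group G] [TopologicalSpace G] : Type (u + 1) :=
  ContAction FintypeCat.{u} G

namespace FinGSet

variable {G : Type u} [Group G] [TopologicalSpace G]

/-- The underlying set of a finite discrete `G`-set. -/
abbrev El (S : FinGSet G) : Type u := S.obj.V.obj

/-- The action of `g` on an element. -/
def act (S : FinGSet G) (g : G) (s : S.El) : S.El :=
  (S.obj.ρ g : S.obj.V ⟶ S.obj.V).hom s

/-- The underlying function of an equivariant map. -/
def fn {S T : FinGSet G} (f : S ⟶ T) (s : S.El) : T.El := f.hom.hom.hom s

lemma act_one (S : FinGSet G) (s : S.El) : S.act 1 s = s :=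
  congrArg (fun φ : S.obj.V ⟶ S.obj.V => φ.hom s) (map_one S.obj.ρ)

lemma act_mul (S : FinGSet G) (g h : G) (s : S.El) : S.act (g * h) s = S.act g (S.act h s) :=
  congrArg (fun φ : S.obj.V ⟶ S.obj.V => φ.hom s) (map_mul S.obj.ρ g h)

lemma fn_act {S T : FinGSet G} (f : S ⟶ T) (g : G) (s : S.El) :
    fn f (S.act g s) = T.act g (fn f s) :=
  congrArg (fun φ : S.obj.V ⟶ T.obj.V => φ.hom s) (f.hom.comm g)

lemma continuous_act (S : FinGSet G) (s : S.El) :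
    @Continuous G S.El _ ⊥ (fun g => S.act g s) := by
  let _ : TopologicalSpace S.El := ⊥
  exact ((Action.isContinuous_def S.obj).1 S.property).comp
    (Continuous.prodMk continuous_id (continuous_const (y := s)))

/-- The fibre product of finite discrete `G`-sets. -/
def pull {S T W : FinGSet G} (f : T ⟶ S) (h : W ⟶ S) : FinGSet G where
  obj :=
    { V := FintypeCat.of {p : T.El × W.El // fn f p.1 = fn h p.2}
      ρ :=
        { toFun g := FintypeCat.homMk (fun p => ⟨(T.act g p.1.1, W.act g p.1.2), by
            rw [fn_act, fn_act, p.2]⟩)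
          map_one' := FintypeCat.hom_ext _ _ fun p =>
            Subtype.ext (Prod.ext (T.act_one p.1.1) (W.act_one p.1.2))
          map_mul' g g' := FintypeCat.hom_ext _ _ fun p =>
            Subtype.ext (Prod.ext (T.act_mul g g' p.1.1) (W.act_mul g g' p.1.2)) } }
  property := by
    rw [Action.isContinuous_def]
    let Z := {p : T.El × W.El // fn f p.1 = fn h p.2}
    let _ : TopologicalSpace Z := ⊥
    have _ : DiscreteTopology Z := ⟨rfl⟩
    let a (g : G) (p : Z) : Z := ⟨(T.act g p.1.1, W.act g p.1.2), by rw [fn_act, fn_act, p.2]⟩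
    change Continuous (fun x : G × Z => a x.1 x.2)
    refine continuous_prod_of_discrete_right.2 fun p => ?_
    have h₁ := T.continuous_act p.1.1
    have h₂ := W.continuous_act p.1.2
    refine continuous_discrete_rng.2 fun q => ?_
    have e : (fun g : G => a g p) ⁻¹' {q} =
        (fun g => T.act g p.1.1) ⁻¹' {q.1.1} ∩ (fun g => W.act g p.1.2) ⁻¹' {q.1.2} := by
      ext g
      constructor
      · intro hg
        have hg' : a g p = q := hg
        exact ⟨congrArg (fun z : Z => z.1.1) hg', congrArg (fun z : Z => z.1.2) hg'⟩
      · intro hg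
        exact Subtype.ext (Prod.ext hg.1 hg.2)
    refine Eq.mpr (congrArg IsOpen e) (IsOpen.inter ?_ ?_)
    · exact @IsOpen.preimage G T.El _ ⊥ _ h₁ _ trivial
    · exact @IsOpen.preimage G W.El _ ⊥ _ h₂ _ trivial

/-- The first projection of the fibre product. -/
def pullFst {S T W : FinGSet G} (f : T ⟶ S) (h : W ⟶ S) : pull f h ⟶ T :=
  ObjectProperty.homMk { hom := FintypeCat.homMk (fun p => p.1.1), comm := fun _ => rfl }

/-- The second projection of the fibre product. -/
def pullSnd {S T W : FinGSet G} (f : T ⟶ S) (h : W ⟶ S) : pull f h ⟶ W :=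
  ObjectProperty.homMk { hom := FintypeCat.homMk (fun p => p.1.2), comm := fun _ => rfl }

lemma pull_condition {S T W : FinGSet G} (f : T ⟶ S) (h : W ⟶ S) :
    pullFst f h ≫ f = pullSnd f h ≫ h := by
  apply ObjectProperty.hom_ext
  apply Action.hom_ext
  exact FintypeCat.hom_ext _ _ fun p => p.2

/-- The topology on finite discrete `G`-sets: a sieve on `S` is covering if it contains a jointly
surjective family of maps to `S`. -/
def topology (G : Type u) [Group G] [TopologicalSpace G] : GrothendieckTopology (FinGSet G) where
  sieves S := {R | ∀ s : S.El, ∃ (T : FinGSet G) (f : T ⟶ S) (t : T.El), R f ∧ fn f t = s}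
  top_mem' S s := ⟨S, 𝟙 S, s, trivial, rfl⟩
  pullback_stable' S T R f hR t := by
    obtain ⟨W, h, w, hRh, hw⟩ := hR (fn f t)
    refine ⟨pull f h, pullFst f h, ⟨(t, w), hw.symm⟩, ?_, rfl⟩
    change R (pullFst f h ≫ f)
    rw [pull_condition]
    exact R.downward_closed hRh _
  transitive' S R hR R' h s := by
    obtain ⟨T, f, t, hf, rfl⟩ := hR s
    obtain ⟨W, k, w, hk, rfl⟩ := h hf t
    exact ⟨W, k ≫ f, w, hk, rfl⟩

end FinGSet

/-! ### Presheaves of spectra on finite discrete `G`-sets -/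

section Presheaves

variable {G : Type u} [Group G] [TopologicalSpace G]

/-- The spectrum `Hom_G(S, Y)`, with simplices `Hom_G(S, Y)ₖ,ₙ = Hom_G(S, (Yₖ)ₙ)`, as a
subspectrum of the product of copies of `Y` indexed by the elements of `S`. -/
def homGSub (S : FinGSet G) (Y : GSpectrum G) : Sub (Spectrum.prod fun _ : S.El => Y.V) where
  carrier k n := Set.ofPred fun f : S.El → Y.V.Simplex k n =>
    ∀ (g : G) (s : S.El), f (S.act g s) = Y.act g (f s)
  map_mem θ f hf g s := (congrArg _ (hf g s)).trans (Y.act_map g θ (f s)).symm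
  pt_mem k n g _ := (Y.act_pt g k n).symm
  sus_mem t f hf g s := (congrArg _ (hf g s)).trans (Y.act_sus g t (f s)).symm

/-- The presheaf of spectra `Hom_G(-, Y)` on finite discrete `G`-sets, as a functor of `Y`. -/
def homG (G : Type u) [Group G] [TopologicalSpace G] :
    GSpectrum G ⥤ (FinGSet G)ᵒᵖ ⥤ Spectrum.{u} where
  obj Y :=
    { obj S := (homGSub S.unop Y).toSpectrum
      map {S T} φ := (homGSub T.unop Y).lift
        (prodLift fun t => (homGSub S.unop Y).ι ≫ prodπ _ (FinGSet.fn φ.unop t))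
        (fun _ _ f g t =>
          (congrArg f.1 (FinGSet.fn_act φ.unop g t)).trans (f.2 g (FinGSet.fn φ.unop t)))
      map_id _ := rfl
      map_comp _ _ := rfl }
  map {Y Z} ψ :=
    { app S := (homGSub S.unop Z).lift
        (prodLift fun s => (homGSub S.unop Y).ι ≫ prodπ _ s ≫ ψ.hom)
        (fun _ _ f g s => (congrArg (ap ψ.hom) (f.2 g s)).trans (GSpectrum.ap_act ψ g (f.1 s)))
      naturality _ _ _ := rfl }
  map_id _ := rfl
  map_comp _ _ := rfl

/-- The presheaf `Hom_G(-, Y)` associated to a discrete `G`-spectrum `Y`. -/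
abbrev discreteHomG (G : Type u) [Group G] [TopologicalSpace G] :
    DiscreteGSpectrum G ⥤ (FinGSet G)ᵒᵖ ⥤ Spectrum.{u} :=
  (GSpectrum.isDiscrete G).ι ⋙ homG G

/-- The homotopy limit of a diagram of presheaves of spectra, formed objectwise:
`(holim P)(S) = holim (P(S))`. -/
def holimPresheaf {C : Type u} [SmallCategory C] (P : C ⥤ (FinGSet G)ᵒᵖ ⥤ Spectrum.{u}) :
    (FinGSet G)ᵒᵖ ⥤ Spectrum.{u} :=
  P.flip ⋙ holimFunctor C

end Presheaves

end

/-! Everything is decided on simplices, where the statement becomes one about sets of equivariant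
functions.

The functor `Hom_G(S, -)` commutes with homotopy limits of `G`-spectra. A simplex of `holim_C
Hom_G(S, X)` is a family of simplicial maps `Δ[n] × B(C ↓ c) ⟶ Hom_G(S, X(c)_k)` subject to
equalizer conditions. Since simplices of `Hom_G(S, X(c))` are equivariant functions of `s`, and
since simplicial operators, diagram maps and the group action are applied pointwise in `s`,
exchanging the order of the variables turns such a family into an equivariant function from `S` to
the simplices of `holim_C X`. This is `holimHomGComparison_app_bijective`.

The `G`-spectrum `Y = holim_C X` need not be discrete, but `Hom_G(S, -)` sees only its discrete
part. The stabilizer of a point `s` of a finite discrete `G`-set is open, so it contains an open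
normal subgroup `N` because `G` is profinite; an equivariant function then sends `s` into `Y^N`.
Hence `colim_N Y^N ⟶ Y` induces an isomorphism on `Hom_G(-, -)`, which is
`isIso_homG_map_colimFixedι`.

Finally, equivariant functions can be glued along jointly surjective families (`isSheaf_homG`), and
the sheaf property passes across the isomorphism. -/

noncomputable section

open PointedSSet Spectrum

/-! ### Isomorphisms of spectra and simplices of homotopy limits -/

namespace Spectrum

/-- A map of spectra that is bijective on simplices is an isomorphism. -/
lemma isIso_of_bijective {X Y : Spectrum.{u}} (f : X ⟶ Y)
    (hf : ∀ k n, Function.Bijective (fun x : X.Simplex k n => ap f x)) : IsIso f := by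
  let e (k : ℕ) (n : SimplexCategoryᵒᵖ) : X.Simplex k n ≃ Y.Simplex k n :=
    Equiv.ofBijective _ (hf k n)
  have he (k n) (y : Y.Simplex k n) : ap f ((e k n).symm y) = y := (e k n).apply_symm_apply y
  have hinj {k n} {x x' : X.Simplex k n} (h : ap f x = ap f x') : x = x' := (hf k n).1 h
  -- The simplexwise inverses form a map of spectra: each compatibility can be checked after
  -- applying the injective map `f`, which is itself compatible.
  refine ⟨homMk (fun k n => (e k n).symm) (fun θ y => hinj ?_) (fun k n => hinj ?_)
    (fun t y => hinj ?_), ?_, ?_⟩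
  · rw [he, ap_map, he]
  · rw [he, ap_pt]
  · rw [he, ap_sus, he]
  · ext k n x
    exact (e k n).symm_apply_apply x
  · ext k n y
    exact he k n y

/-- Two simplices of a homotopy limit agree if all their components agree. -/
lemma holim_simplex_ext {C : Type u} [SmallCategory C] {X : C ⥤ Spectrum.{u}} {k n}
    {x y : (holim X).Simplex k n} (h : ∀ (c : C) m p, (x.1 c).app m p = (y.1 c).app m p) :
    x = y :=
  Subtype.ext (funext fun c => NatTrans.ext (funext fun m => types_ext fun p => h c m p))

/-- The compatibility of the components of a simplex of a homotopy limit. -/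
lemma holim_simplex_condition {C : Type u} [SmallCategory C] {X : C ⥤ Spectrum.{u}} {k n}
    (x : (holim X).Simplex k n) {c d : C} (σ : c ⟶ d) {m : SimplexCategoryᵒᵖ}
    (a : (SSet.stdSimplex.obj n.unop).obj m) (b : (overNerve c).obj m) :
    ap (X.map σ) ((x.1 c).app m (a, b)) =
      (x.1 d).app m (a, (overNerveMap σ).app m b) := by
  -- Membership in the equalizer is an equality of families indexed by arrows; only its component at
  -- `σ` is needed.
  have h := congrFun x.2 (Arrow.mk σ)
  exact congrArg (fun φ : SSet.stdSimplex.obj n.unop ⊗ overNerve c ⟶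
    ((X.obj d).level k).sset => φ.app m (a, b)) h

end Spectrum

/-! ### Descent for equivariant functions -/

section Sheaf

variable {G : Type u} [Group G] [TopologicalSpace G]

/-- The value at `s` of a map of spectra `E ⟶ Hom_G(S, Y)`. -/
def homGEval {Y : GSpectrum G} {S : FinGSet G} {E : Spectrum.{u}}
    (x : E ⟶ ((homG G).obj Y).obj (op S)) (s : S.El) {k n} (e : E.Simplex k n) :
    Y.V.Simplex k n :=
  (ap x e).1 s

lemma homGEval_ext {Y : GSpectrum G} {S : FinGSet G} {E : Spectrum.{u}}
    {x y : E ⟶ ((homG G).obj Y).obj (op S)}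
    (h : ∀ s k n (e : E.Simplex k n), homGEval x s e = homGEval y s e) : x = y :=
  Spectrum.hom_ext fun k n e => Subtype.ext (funext fun s => h s k n e)

/-- The presheaf of spectra `Hom_G(-, Y)` is a sheaf for every `G`-spectrum `Y`. -/
lemma isSheaf_homG (Y : GSpectrum G) :
    Presheaf.IsSheaf (FinGSet.topology G) ((homG G).obj Y) := by
  -- A presheaf of spectra is a sheaf when maps into it from each test spectrum `E` satisfy descent;
  -- `x` is a compatible family of such maps.
  intro E S R hR x hx
  have hR' (s : S.El) : ∃ (T : FinGSet G) (f : T ⟶ S) (t : T.El), R f ∧ FinGSet.fn f t = s :=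
    hR s
  choose T f t hf hft using hR'
  -- Two points over the same element of `S` define a point `(t, w)` of the fibre product, and
  -- compatibility of `x` on the fibre product, evaluated there, identifies the two values.
  have hind {k n} (e : E.Simplex k n) {T W : FinGSet G} (f : T ⟶ S) (h : W ⟶ S) (hf : R f)
      (hh : R h) (t : T.El) (w : W.El) (htw : FinGSet.fn f t = FinGSet.fn h w) :
      homGEval (x f hf) t e = homGEval (x h hh) w e := by
    have h := hx (FinGSet.pullFst f h) (FinGSet.pullSnd f h) hf hh (FinGSet.pull_condition f h)
    exact congrArg (fun φ : E ⟶ ((homG G).obj Y).obj (op (FinGSet.pull f _)) =>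
      homGEval φ ⟨(t, w), htw⟩ e) h
  -- The glued value at `s` is read off at the chosen preimage `t s`; by `hind` any other preimage
  -- gives the same value.
  let v {k n} (e : E.Simplex k n) (s : S.El) : Y.V.Simplex k n := homGEval (x (f s) (hf s)) (t s) e
  have hv {k n} (e : E.Simplex k n) {T : FinGSet G} (h : T ⟶ S) (hh : R h) (t : T.El) :
      v e (FinGSet.fn h t) = homGEval (x h hh) t e := hind e _ _ _ _ _ _ (hft _)
  have hmem {k n} (e : E.Simplex k n) (g : G) (s : S.El) : v e (S.act g s) = Y.act g (v e s) := by
    -- The translate of `t s` by `g` is a preimage of the translate of `s`, so it may replace the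
    -- chosen one, and equivariance upstairs applies.
    have h₁ := hv e (f s) (hf s) ((T s).act g (t s))
    rw [FinGSet.fn_act, hft] at h₁
    exact h₁.trans ((ap (x (f s) (hf s)) e).2 g (t s))
  -- The chosen preimage depends on `s` alone, not on `e` or its degrees, so each compatibility of
  -- `y` at `s` is inherited from the single map `x (f s) (hf s)`.
  let y : E ⟶ ((homG G).obj Y).obj (op S) := homMk (fun k n e => ⟨v e, hmem e⟩)
    (fun θ e => Subtype.ext (funext fun s =>
      congrArg (fun z => z.1 (t s)) (ap_map (x (f s) (hf s)) θ e)))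
    (fun k n => Subtype.ext (funext fun s =>
      congrArg (fun z => z.1 (t s)) (ap_pt (x (f s) (hf s)) k n)))
    (fun τ e => Subtype.ext (funext fun s =>
      congrArg (fun z => z.1 (t s)) (ap_sus (x (f s) (hf s)) τ e)))
  refine ⟨y, fun T h hh => homGEval_ext fun t k n e => hv e h hh t, fun z hz => ?_⟩
  -- Uniqueness: the value of `z` at `s` is that of its restriction along `f s` at `t s`, which is
  -- prescribed.
  refine homGEval_ext fun s k n e => ?_
  have h := congrArg (fun φ : E ⟶ ((homG G).obj Y).obj (op (T s)) => homGEval φ (t s) e)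
    (hz (f s) (hf s))
  refine Eq.trans ?_ h
  exact congrArg (fun s => homGEval z s e) (hft s).symm

end Sheaf

/-! ### Equivariant functions into a homotopy limit -/

section Comparison

variable {G : Type u} [Group G] [TopologicalSpace G]

/-- An element of a finite discrete `G`-set is fixed by an open normal subgroup of the
profinite group `G`. -/
lemma FinGSet.exists_openNormalSubgroup_act_eq [IsTopologicalGroup G] [CompactSpace G]
    [TotallyDisconnectedSpace G] (S : FinGSet G) (s : S.El) :
    ∃ N : OpenNormalSubgroup G, ∀ g ∈ N.toSubgroup, S.act g s = s := by
  -- The stabilizer of `s` is open, being the preimage of a point under a continuous map to a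
  -- discrete set; it is then used as a neighbourhood of `1`.
  have hU : IsOpen ((fun g => S.act g s) ⁻¹' {s}) :=
    @IsOpen.preimage G S.El _ ⊥ _ (S.continuous_act s) _ trivial
  obtain ⟨N, hN⟩ := ProfiniteGrp.exist_openNormalSubgroup_sub_open_nhds_of_one hU (S.act_one s)
  exact ⟨N, fun g hg => hN hg⟩

variable {C : Type u} [SmallCategory C] (X : C ⥤ GSpectrum G)

/-- Evaluation at `s`, as a map of diagrams `Hom_G(S, X) ⟶ X`. -/
def homGDiagramEval (S : (FinGSet G)ᵒᵖ) (s : S.unop.El) :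
    (X ⋙ homG G).flip.obj S ⟶ X ⋙ Action.forget Spectrum.{u} G where
  app c := (homGSub S.unop (X.obj c)).ι ≫ prodπ _ s
  naturality _ _ _ := rfl

/-- The group acts on a homotopy limit component by component, and every component value of `x` is
itself an equivariant function on `S`. This makes `s ↦ x(s)` equivariant. -/
lemma ap_holimMap_homGDiagramEval_act (S : (FinGSet G)ᵒᵖ) (g : G) (s : S.unop.El) {k n}
    (x : ((holimPresheaf (X ⋙ homG G)).obj S).Simplex k n) :
    ap (holimMap (homGDiagramEval X S (S.unop.act g s))) x =
      (GSpectrum.holim X).act g (ap (holimMap (homGDiagramEval X S s)) x) :=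
  holim_simplex_ext fun c m p => ((x.1 c).app m p).2 g s

/-- The comparison map `holim_C Hom_G(S, X) ⟶ Hom_G(S, holim_C X)`, which sends `x` to the
function `s ↦ x(s)`. -/
def holimHomGComparison :
    holimPresheaf (X ⋙ homG G) ⟶ (homG G).obj (GSpectrum.holim X) where
  app S := (homGSub S.unop (GSpectrum.holim X)).lift
    (prodLift fun s => holimMap (homGDiagramEval X S s))
    (fun _ _ x g s => ap_holimMap_homGDiagramEval_act X S g s x)
  naturality _ _ _ := rfl

/-- Both sides encode the same functions of `c`, a simplex of `Δ[n] × B(C ↓ c)`, and `s`; only the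
position of the variable `s` differs. -/
lemma holimHomGComparison_app_bijective (S : (FinGSet G)ᵒᵖ) (k n) :
    Function.Bijective (fun x : ((holimPresheaf (X ⋙ homG G)).obj S).Simplex k n =>
      ap ((holimHomGComparison X).app S) x) := by
  constructor
  · intro x y hxy
    refine holim_simplex_ext fun c m p => Subtype.ext (funext fun s => ?_)
    exact congrArg (fun z : (((homG G).obj (GSpectrum.holim X)).obj S).Simplex k n =>
      ((z.1 s).1 c).app m p) hxy
  · intro f
    -- The preimage of `f`: move `s` to the innermost position. Equivariance in `s` and naturality
    -- hold because those of `f` can be read componentwise.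
    let F (c : C) : SSet.stdSimplex.obj n.unop ⊗ overNerve c ⟶
        ((homGSub S.unop (X.obj c)).toSpectrum.level k).sset :=
      { app m := ↾(fun p => ⟨fun s => ((f.1 s).1 c).app m p, fun g s =>
          congrArg (fun z : (GSpectrum.holim X).V.Simplex k n => (z.1 c).app m p) (f.2 g s)⟩)
        naturality m m' θ := types_ext fun p => Subtype.ext (funext fun s =>
          NatTrans.naturality_apply ((f.1 s).1 c) θ p) }
    refine ⟨⟨F, funext fun σ => NatTrans.ext (funext fun m => types_ext fun p =>
      Subtype.ext (funext fun s => ?_))⟩, rfl⟩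
    -- The equalizer condition for `F` is checked at each `s`, where it is the one satisfied by the
    -- simplex `f.1 s` of `holim_C X`.
    exact holim_simplex_condition (f.1 s) σ.hom p.1 p.2

instance : IsIso (holimHomGComparison X) := by
  have (S : (FinGSet G)ᵒᵖ) : IsIso ((holimHomGComparison X).app S) :=
    isIso_of_bijective _ (holimHomGComparison_app_bijective X S)
  exact NatIso.isIso_of_isIso_app _

/-! ### Replacing a `G`-spectrum by its discrete part -/

/-- The equivariant inclusion `colim_N Y^N ⟶ Y`. -/
def GSpectrum.colimFixedι (Y : GSpectrum G) : Y.colimFixedG ⟶ Y where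
  hom := (colimFixedSub Y).ι
  comm _ := rfl

/-- For a profinite group, an equivariant map from a finite discrete `G`-set to `Y` takes values
in `colim_N Y^N`. -/
lemma isIso_homG_map_colimFixedι [IsTopologicalGroup G] [CompactSpace G]
    [TotallyDisconnectedSpace G] (Y : GSpectrum G) : IsIso ((homG G).map Y.colimFixedι) := by
  have (S : (FinGSet G)ᵒᵖ) : IsIso (((homG G).map Y.colimFixedι).app S) := by
    refine isIso_of_bijective _ fun k n => ⟨fun f f' h => ?_, fun f => ?_⟩
    · refine Subtype.ext (funext fun s => Subtype.ext ?_)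
      exact congrArg (fun z : (((homG G).obj Y).obj S).Simplex k n => z.1 s) h
    · refine ⟨⟨fun s => ⟨f.1 s, ?_⟩, fun g s => Subtype.ext (f.2 g s)⟩, rfl⟩
      obtain ⟨N, hN⟩ := S.unop.exists_openNormalSubgroup_act_eq s
      refine Set.mem_iUnion.2 ⟨N, fun g hg => ?_⟩
      -- For `g` in `N`, acting on the value `f s` gives `f (g s) = f s`, so this value is
      -- `N`-fixed.
      exact (f.2 g s).symm.trans (congrArg f.1 (hN g hg))
  exact NatIso.isIso_of_isIso_app _

/-- The isomorphism `holim_C Hom_G(-, X) ≅ Hom_G(-, colim_N (holim_C X)^N)`. -/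
def holimHomGIso [IsTopologicalGroup G] [CompactSpace G] [TotallyDisconnectedSpace G] :
    holimPresheaf (X ⋙ homG G) ≅ (homG G).obj (GSpectrum.holim X).colimFixedG :=
  haveI := isIso_homG_map_colimFixedι (GSpectrum.holim X)
  -- Both isomorphisms end at `Hom_G(-, holim_C X)`, so the second one is inverted.
  asIso (holimHomGComparison X) ≪≫ (asIso ((homG G).map (GSpectrum.holim X).colimFixedι)).symm

end Comparison

end

theorem lemma2p6 (G : Type u) [Group G] [TopologicalSpace G] [IsTopologicalGroup G]
    [CompactSpace G] [T2Space G] [TotallyDisconnectedSpace G]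
    (C : Type u) [SmallCategory C] (X : C ⥤ DiscreteGSpectrum G) :
    Nonempty (holimPresheaf (X ⋙ discreteHomG G) ≅
        (discreteHomG G).obj (DiscreteGSpectrum.holim X).colimFixed) ∧
      Presheaf.IsSheaf (FinGSet.topology G)
        ((discreteHomG G).obj (DiscreteGSpectrum.holim X).colimFixed) ∧
      Presheaf.IsSheaf (FinGSet.topology G) (holimPresheaf (X ⋙ discreteHomG G)) := by
  have e : holimPresheaf (X ⋙ discreteHomG G) ≅
      (discreteHomG G).obj (DiscreteGSpectrum.holim X).colimFixed :=
    holimHomGIso (X ⋙ (GSpectrum.isDiscrete G).ι)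
  have h : Presheaf.IsSheaf (FinGSet.topology G)
      ((discreteHomG G).obj (DiscreteGSpectrum.holim X).colimFixed) := isSheaf_homG _
  exact ⟨⟨e⟩, h, (Presheaf.isSheaf_of_iso_iff e).2 h⟩
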